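/- Theorem $B_{(m,\lambda)}$ (Topological Berge's Theorem). Let $H_q(U)$ denote the reduced singular homology of a topological space $U$ with coefficients in a fixed nonzero abelian group $G$, that is, the homology of the augmented singular chain complex $\cdots\to C_1(U;G)\to C_0(U;G)\to G\to 0$, with $G$ in degree $-1$; in particular $H_{-1}(U)=0$ if and only if $U$ is nonempty. Let $X$ be a topological space, let $m\ge 1$ and $\lambda\ge 0$ be integers, and let $F=\{A_1,\dots,A_m\}$ be a family of open subsets of $X$ (repetitions allowed). Suppose that a) $H_{m-2+\lambda}(A_1\cup\dots\cup A_m)=0$, and b) for every $j$ with $1\le j\le m-1$ and every set of indices $S\subseteq\{1,\dots,m\}$ of size $j$, $H_{m-2-j+\lambda}\bigl(\bigcap_{i\in S}A_i\bigr)=0$. Then $H_{\lambda-1}(A_1\cap\dots\cap A_m)=0$. -/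

import Mathlib

open CategoryTheory CategoryTheory.Limits

universe u v

section Augmentation

variable {C : Type*} [Category C] [HasCoproducts.{u} C] [Preadditive C]

/-- The augmentation `C₀(K; R) ⟶ R` of the chain complex of a simplicial set `K`: it is the
identity of `R` on the summand of every `0`-simplex. -/
noncomputable def chainAugmentation (K : SSet.{u}) (R : C) : (K.chainComplex R).X 0 ⟶ R :=
  (K.isColimitChainComplexXCofan R 0).desc (Cofan.mk R fun _ => 𝟙 R)

theorem ι_chainAugmentation (K : SSet.{u}) (R : C)
    (x : K.obj (Opposite.op (SimplexCategory.mk 0))) :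
    K.ιChainComplex x ≫ chainAugmentation K R = 𝟙 R :=
  (K.isColimitChainComplexXCofan R 0).fac (Cofan.mk R fun _ => 𝟙 R) (Discrete.mk x)

theorem d_chainAugmentation (K : SSet.{u}) (R : C) :
    (K.chainComplex R).d 1 0 ≫ chainAugmentation K R = 0 := by
  refine SSet.chainComplex_hom_ext fun x => ?_
  have h := K.ιChainComplex_d_assoc (R := R) (n := 0) x (chainAugmentation K R)
  refine h.trans ?_
  rw [Limits.comp_zero, Fin.sum_univ_two, Preadditive.add_comp, Preadditive.zsmul_comp,
    Preadditive.zsmul_comp, ι_chainAugmentation, ι_chainAugmentation]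
  simp

end Augmentation

/-- The augmented singular chain complex `⋯ ⟶ C₁(Y; G) ⟶ C₀(Y; G) ⟶ G ⟶ 0` of a topological
space `Y` with coefficients in an abelian group `G`, that is, Mathlib's singular chain complex
augmented by `G`. Indices are shifted by one: `G` sits in degree `0` and `C_n(Y; G)` in degree
`n + 1`. (`ULift` only serves to have `G` and `Y` in arbitrary universes.) -/
noncomputable def augmentedSingularChainComplex (G : Type v) [AddCommGroup G]
    (Y : Type u) [TopologicalSpace Y] : ChainComplex AddCommGrpCat.{max u v} ℕ :=
  (((AlgebraicTopology.singularChainComplexFunctor AddCommGrpCat.{max u v}).obj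
    (AddCommGrpCat.of (ULift.{u} G))).obj (TopCat.of Y)).augment
      (chainAugmentation (TopCat.toSSet.obj (TopCat.of Y)) (AddCommGrpCat.of (ULift.{u} G)))
      (d_chainAugmentation _ _)

/-- The reduced singular homology group `H_q(Y; G)` for every integer `q`: the homology of the
augmented singular chain complex at `C_q(Y; G)` if `q ≥ 0` and at `G` if `q = -1` (so that, for
`G ≠ 0`, it vanishes for `q = -1` if and only if `Y` is nonempty), and zero if `q < -1`. -/
noncomputable def reducedSingularHomology (G : Type v) [AddCommGroup G]
    (Y : Type u) [TopologicalSpace Y] : ℤ → AddCommGrpCat.{max u v}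
  | Int.ofNat n => (augmentedSingularChainComplex G Y).homology (n + 1)
  | Int.negSucc 0 => (augmentedSingularChainComplex G Y).homology 0
  | Int.negSucc (_ + 1) => AddCommGrpCat.of PUnit

/-- The usual convention in degree `-1`: `H_{-1}(Y; G) = 0` means that `Y` is nonempty. -/
theorem isZero_reducedSingularHomology_neg_one_iff (G : Type v) [AddCommGroup G] [Nontrivial G]
    (Y : Type u) [TopologicalSpace Y] :
    IsZero (reducedSingularHomology G Y (-1)) ↔ Nonempty Y := by
  change IsZero ((augmentedSingularChainComplex G Y).homology 0) ↔ _
  rw [← HomologicalComplex.exactAt_iff_isZero_homology,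
    HomologicalComplex.exactAt_iff' _ 1 0 0 (by simp) (by simp), ShortComplex.exact_iff_epi]
  swap
  · exact (augmentedSingularChainComplex G Y).shape 0 0 (by simp)
  change Epi (chainAugmentation (TopCat.toSSet.obj (TopCat.of Y)) (AddCommGrpCat.of (ULift.{u} G))) ↔ _
  constructor
  · intro h
    by_contra hY
    have h0 : 𝟙 (AddCommGrpCat.of (ULift.{u} G)) = 0 := by
      rw [← cancel_epi (chainAugmentation (TopCat.toSSet.obj (TopCat.of Y)) (AddCommGrpCat.of (ULift.{u} G)))]
      refine SSet.chainComplex_hom_ext fun x => ?_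
      have y : Y := (TopCat.toSSetObjEquiv _ _ x : C(_, _)) (Classical.arbitrary _)
      exact (hY ⟨y⟩).elim
    obtain ⟨g, hg⟩ := exists_ne (0 : G)
    have := congr(($h0).hom (ULift.up g))
    exact hg (congrArg ULift.down this)
  · rintro ⟨y⟩
    have := ι_chainAugmentation (TopCat.toSSet.obj (TopCat.of Y)) (AddCommGrpCat.of (ULift.{u} G))
      ((TopCat.toSSetObjEquiv _ _).symm (ContinuousMap.const _ y))
    exact epi_of_epi_fac this

/-! Only vanishing is needed, so the argument rests on two consequences of the Mayer–Vietoris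
sequence for open sets A, B. If H_q(A), H_q(B) and H_{q-1}(A ∩ B) vanish, so does H_q(A ∪ B)
(`Acyclic.union`). If H_q(A), H_q(B) and H_{q+1}(A ∪ B) vanish, so does H_q(A ∩ B)
(`Acyclic.inter`). The theorem follows by induction on the number of sets (`acyclic_iInter`):
replace the family by the sets A_i ∩ A_last, which has one member fewer and the same total
intersection. Its union is (⋃ A_i) ∩ A_last, over i ≠ last, so `Acyclic.inter` applies once the
union of all sets but the last is known to be acyclic; that is a nerve-type induction using
`Acyclic.union` (`acyclic_iUnion`). Both consequences are proved on chains. Barycentric subdivision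
is chain homotopic to the identity, and a Lebesgue number argument makes every simplex of an
iterated subdivision lie in A or in B (`exists_sdIter_mem_sup`). Simplices are indexed by their
number of vertices, n vertices meaning degree n - 1, so the augmentation becomes the boundary onto
the empty simplex. -/

/-! ### Chains on tuples of points: boundary and cones. -/

namespace TupleChain

variable {V W : Type*} {R : Type*} [AddCommGroup R]

/-- The boundary of the free augmented complex on tuples of points of `V`; a tuple with `n` entries
is an `(n - 1)`-simplex. -/
noncomputable def d (V R : Type*) [AddCommGroup R] (n : ℕ) :
    ((Fin (n + 1) → V) →₀ R) →+ ((Fin n → V) →₀ R) :=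
  ∑ i : Fin (n + 1), (-1 : ℤ) ^ (i : ℕ) •
    Finsupp.mapDomain.addMonoidHom (fun v : Fin (n + 1) → V => v ∘ i.succAbove)

/-- The cone operator with apex `p`. -/
noncomputable def cone (p : V) (n : ℕ) : ((Fin n → V) →₀ R) →+ ((Fin (n + 1) → V) →₀ R) :=
  Finsupp.mapDomain.addMonoidHom fun v : Fin n → V => (Fin.cons p v : Fin (n + 1) → V)

/-- The map induced on tuple chains by a map of vertices. -/
noncomputable def map (φ : V → W) (n : ℕ) : ((Fin n → V) →₀ R) →+ ((Fin n → W) →₀ R) :=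
  Finsupp.mapDomain.addMonoidHom (φ ∘ ·)

theorem d_single (n : ℕ) (v : Fin (n + 1) → V) (g : R) :
    d V R n (.single v g) =
      ∑ i : Fin (n + 1), (-1 : ℤ) ^ (i : ℕ) • .single (v ∘ i.succAbove) g := by
  simp [d]

@[simp]
theorem cone_single (p : V) (n : ℕ) (v : Fin n → V) (g : R) :
    cone p n (.single v g) = .single (Fin.cons p v : Fin (n + 1) → V) g := by
  simp [cone]

@[simp]
theorem map_single (φ : V → W) (n : ℕ) (v : Fin n → V) (g : R) :
    map φ n (.single v g) = .single (φ ∘ v) g := by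
  simp [map]

theorem d_map (φ : V → W) (n : ℕ) (c : (Fin (n + 1) → V) →₀ R) :
    d W R n (map φ (n + 1) c) = map φ n (d V R n c) := by
  induction c using Finsupp.induction_linear with
  | zero => simp
  | add a b ha hb => simp [ha, hb]
  | single v g => simp [d_single, Function.comp_assoc]

theorem map_cone (φ : V → W) (p : V) (n : ℕ) (c : (Fin n → V) →₀ R) :
    map φ (n + 1) (cone p n c) = cone (φ p) n (map φ n c) := by
  induction c using Finsupp.induction_linear with
  | zero => simp
  | add a b ha hb => simp [ha, hb]
  | single v g =>
    simp only [cone_single, map_single]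
    congr 1
    ext i
    refine Fin.cases ?_ (fun j => ?_) i <;> simp

theorem d_cone_zero (p : V) (c : (Fin 0 → V) →₀ R) : d V R 0 (cone p 0 c) = c := by
  induction c using Finsupp.induction_linear with
  | zero => simp
  | add a b ha hb => simp [ha, hb]
  | single v g =>
    simp only [cone_single, d_single]
    simp [Subsingleton.elim _ v]

/-- Deleting the apex returns the base; every other face is a cone over a face of the base, with its
sign shifted by one. -/
theorem d_cone (p : V) (n : ℕ) (c : (Fin (n + 1) → V) →₀ R) :
    d V R (n + 1) (cone p (n + 1) c) = c - cone p n (d V R n c) := by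
  induction c using Finsupp.induction_linear with
  | zero => simp
  | add a b ha hb => simp only [map_add, ha, hb]; abel
  | single v g =>
    simp only [cone_single, d_single, Fin.sum_univ_succ (n := n + 1), map_sum, map_zsmul]
    rw [sub_eq_add_neg, ← Finset.sum_neg_distrib]
    congr 1
    · simp
    · refine Finset.sum_congr rfl fun i _ => ?_
      rw [Fin.val_succ, pow_succ, mul_neg_one, neg_smul]
      congr 3
      ext j
      refine Fin.cases ?_ (fun j => ?_) j <;> simp

/-- Every tuple is the cone over its tail with apex its first entry, so the cone formula reduces the
claim to one vertex fewer. -/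
theorem d_d (n : ℕ) (c : (Fin (n + 2) → V) →₀ R) : d V R n (d V R (n + 1) c) = 0 := by
  induction n with
  | zero =>
    induction c using Finsupp.induction_linear with
    | zero => simp
    | add a b ha hb => simp [ha, hb]
    | single v g =>
      rw [← Fin.cons_self_tail v, ← cone_single, d_cone, map_sub, d_cone_zero, sub_self]
  | succ n ih =>
    induction c using Finsupp.induction_linear with
    | zero => simp
    | add a b ha hb => simp [ha, hb]
    | single v g =>
      rw [← Fin.cons_self_tail v, ← cone_single, d_cone, map_sub, d_cone, ih]
      simp

end TupleChain

/-! ### Affine maps and barycenters in standard simplices. -/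

namespace stdSimplex

variable {k l n : ℕ}

/-- The affine map of standard simplices with prescribed values at the vertices. -/
noncomputable def aff (v : Fin n → stdSimplex ℝ (Fin k)) (t : stdSimplex ℝ (Fin n)) :
    stdSimplex ℝ (Fin k) :=
  ⟨∑ i, t i • (v i : Fin k → ℝ),
    (convex_stdSimplex ℝ (Fin k)).sum_mem (fun i _ => t.2.1 i) t.2.2 fun i _ => (v i).2⟩

theorem coe_aff (v : Fin n → stdSimplex ℝ (Fin k)) (t : stdSimplex ℝ (Fin n)) :
    (aff v t : Fin k → ℝ) = ∑ i, t i • (v i : Fin k → ℝ) := rfl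

theorem aff_apply (v : Fin n → stdSimplex ℝ (Fin k)) (t : stdSimplex ℝ (Fin n)) (j : Fin k) :
    aff v t j = ∑ i, t i * v i j := by
  rw [coe_aff, Finset.sum_apply]
  rfl

theorem continuous_aff (v : Fin n → stdSimplex ℝ (Fin k)) : Continuous (aff v) := by
  refine Continuous.subtype_mk ?_ _
  refine continuous_finsetSum _ fun i _ => Continuous.fun_smul ?_ continuous_const
  exact (continuous_apply i).comp continuous_subtype_val

theorem aff_vertex (v : Fin n → stdSimplex ℝ (Fin k)) (i : Fin n) : aff v (vertex i) = v i := by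
  ext j
  rw [aff_apply, Finset.sum_eq_single i]
  · simp
  · intro b _ hb
    simp [hb]
  · simp

theorem aff_comp_vertex (v : Fin n → stdSimplex ℝ (Fin k)) : aff v ∘ vertex = v :=
  funext (aff_vertex v)

theorem vertex_aff (t : stdSimplex ℝ (Fin n)) : aff vertex t = t := by
  ext j
  rw [aff_apply, Finset.sum_eq_single j]
  · simp
  · intro b _ hb
    simp [hb.symm]
  · simp

theorem aff_aff (w : Fin k → stdSimplex ℝ (Fin l)) (v : Fin n → stdSimplex ℝ (Fin k))
    (t : stdSimplex ℝ (Fin n)) : aff (aff w ∘ v) t = aff w (aff v t) := by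
  ext j
  simp only [aff_apply, Function.comp, Finset.mul_sum, Finset.sum_mul]
  rw [Finset.sum_comm]
  simp only [mul_assoc]

/-- The barycenter of a nonempty tuple of points of a simplex. -/
noncomputable def bary (v : Fin (n + 1) → stdSimplex ℝ (Fin k)) : stdSimplex ℝ (Fin k) :=
  aff v barycenter

theorem bary_aff_comp (w : Fin k → stdSimplex ℝ (Fin l)) (v : Fin (n + 1) → stdSimplex ℝ (Fin k)) :
    bary (aff w ∘ v) = aff w (bary v) :=
  aff_aff w v _

end stdSimplex

/-! ### Barycentric subdivision of affine chains and its homotopy to the identity. -/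

namespace TupleChain

open stdSimplex

variable {R : Type*} [AddCommGroup R] {k l : ℕ}

/-- Barycentric subdivision of affine chains. -/
noncomputable def sd (R : Type*) [AddCommGroup R] (k : ℕ) : (n : ℕ) →
    ((Fin n → stdSimplex ℝ (Fin k)) →₀ R) →+ ((Fin n → stdSimplex ℝ (Fin k)) →₀ R)
  | 0 => AddMonoidHom.id _
  | n + 1 => Finsupp.liftAddHom fun v => (cone (bary v) n).comp
      ((sd R k n).comp ((d _ R n).comp (Finsupp.singleAddHom v)))

theorem sd_succ_single (n : ℕ) (v : Fin (n + 1) → stdSimplex ℝ (Fin k)) (g : R) :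
    sd R k (n + 1) (.single v g) = cone (bary v) n (sd R k n (d _ R n (.single v g))) := by
  simp [sd]

/-- The chain homotopy between the identity and barycentric subdivision. -/
noncomputable def sdHomotopy (R : Type*) [AddCommGroup R] (k : ℕ) : (n : ℕ) →
    ((Fin n → stdSimplex ℝ (Fin k)) →₀ R) →+ ((Fin (n + 1) → stdSimplex ℝ (Fin k)) →₀ R)
  | 0 => 0
  | n + 1 => Finsupp.liftAddHom fun v => (cone (bary v) (n + 1)).comp
      ((AddMonoidHom.id _ - (sdHomotopy R k n).comp (d _ R n)).comp (Finsupp.singleAddHom v))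

theorem sdHomotopy_succ_single (n : ℕ) (v : Fin (n + 1) → stdSimplex ℝ (Fin k)) (g : R) :
    sdHomotopy R k (n + 1) (.single v g) = cone (bary v) (n + 1)
      (.single v g - sdHomotopy R k n (d _ R n (.single v g))) := by
  simp [sdHomotopy]

/-- With b the barycenter of v, the cone formula gives d(sd v) = sd(dv) - cone_b(d(sd(dv))); the
last term is zero by induction and d² = 0. -/
theorem d_sd (n : ℕ) (c : (Fin (n + 1) → stdSimplex ℝ (Fin k)) →₀ R) :
    d _ R n (sd R k (n + 1) c) = sd R k n (d _ R n c) := by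
  induction n with
  | zero =>
    induction c using Finsupp.induction_linear with
    | zero => simp
    | add a b ha hb => simp [ha, hb]
    | single v g => rw [sd_succ_single, d_cone_zero]
  | succ n ih =>
    induction c using Finsupp.induction_linear with
    | zero => simp
    | add a b ha hb => simp only [map_add, ha, hb]
    | single v g => rw [sd_succ_single, d_cone, ih, d_d]; simp

theorem d_sdHomotopy_zero (c : (Fin 0 → stdSimplex ℝ (Fin k)) →₀ R) :
    d _ R 0 (sdHomotopy R k 0 c) = c - sd R k 0 c := by
  simp [sdHomotopy, sd]

/-- Write T for the homotopy and b for the barycenter of v. By induction d(v - T(dv)) = sd(dv), so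
the correction term in the cone formula for T(v) is cone_b(sd(dv)) = sd(v). -/
theorem d_sdHomotopy (n : ℕ) (c : (Fin (n + 1) → stdSimplex ℝ (Fin k)) →₀ R) :
    d _ R (n + 1) (sdHomotopy R k (n + 1) c) + sdHomotopy R k n (d _ R n c) =
      c - sd R k (n + 1) c := by
  induction n with
  | zero =>
    induction c using Finsupp.induction_linear with
    | zero => simp
    | add a b ha hb =>
      simp only [map_add]
      rw [add_sub_add_comm, ← ha, ← hb]
      abel
    | single v g =>
      rw [sdHomotopy_succ_single, d_cone, map_sub, d_sdHomotopy_zero, sub_sub_cancel,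
        sd_succ_single]
      abel
  | succ n ih =>
    induction c using Finsupp.induction_linear with
    | zero => simp
    | add a b ha hb =>
      simp only [map_add]
      rw [add_sub_add_comm, ← ha, ← hb]
      abel
    | single v g =>
      have h := ih (d _ R (n + 1) (.single v g))
      rw [d_d, map_zero, add_zero] at h
      rw [sdHomotopy_succ_single, d_cone, map_sub, h, sub_sub_cancel, sd_succ_single]
      abel

/-- Affine maps preserve barycenters. This naturality is what carries subdivision over to singular
simplices. -/
theorem map_sd (w : Fin k → stdSimplex ℝ (Fin l)) (n : ℕ)
    (c : (Fin n → stdSimplex ℝ (Fin k)) →₀ R) :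
    map (aff w) n (sd R k n c) = sd R l n (map (aff w) n c) := by
  induction n with
  | zero => rfl
  | succ n ih =>
    induction c using Finsupp.induction_linear with
    | zero => simp
    | add a b ha hb => simp only [map_add, ha, hb]
    | single v g =>
      rw [sd_succ_single, map_cone, ih, ← d_map, map_single, sd_succ_single, bary_aff_comp]

theorem map_sdHomotopy (w : Fin k → stdSimplex ℝ (Fin l)) (n : ℕ)
    (c : (Fin n → stdSimplex ℝ (Fin k)) →₀ R) :
    map (aff w) (n + 1) (sdHomotopy R k n c) = sdHomotopy R l n (map (aff w) n c) := by
  induction n with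
  | zero => simp [sdHomotopy]
  | succ n ih =>
    induction c using Finsupp.induction_linear with
    | zero => simp
    | add a b ha hb => simp only [map_add, ha, hb]
    | single v g =>
      rw [sdHomotopy_succ_single, map_cone, map_sub, ih, ← d_map, map_single,
        sdHomotopy_succ_single, bary_aff_comp]

/-- The `N`-fold barycentric subdivision of affine chains. -/
noncomputable def sdIter (R : Type*) [AddCommGroup R] (k n : ℕ) : ℕ →
    ((Fin n → stdSimplex ℝ (Fin k)) →₀ R) →+ ((Fin n → stdSimplex ℝ (Fin k)) →₀ R)
  | 0 => AddMonoidHom.id _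
  | N + 1 => (sd R k n).comp (sdIter R k n N)

/-- The chain homotopy between the identity and the `N`-fold barycentric subdivision. -/
noncomputable def sdIterHomotopy (R : Type*) [AddCommGroup R] (k n : ℕ) : ℕ →
    ((Fin n → stdSimplex ℝ (Fin k)) →₀ R) →+ ((Fin (n + 1) → stdSimplex ℝ (Fin k)) →₀ R)
  | 0 => 0
  | N + 1 => sdIterHomotopy R k n N + (sdHomotopy R k n).comp (sdIter R k n N)

theorem d_sdIter (N n : ℕ) (c : (Fin (n + 1) → stdSimplex ℝ (Fin k)) →₀ R) :
    d _ R n (sdIter R k (n + 1) N c) = sdIter R k n N (d _ R n c) := by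
  induction N with
  | zero => rfl
  | succ N ih => simp [sdIter, d_sd, ih]

theorem d_sdIterHomotopy (N n : ℕ) (c : (Fin (n + 1) → stdSimplex ℝ (Fin k)) →₀ R) :
    d _ R (n + 1) (sdIterHomotopy R k (n + 1) N c) + sdIterHomotopy R k n N (d _ R n c) =
      c - sdIter R k (n + 1) N c := by
  induction N with
  | zero => simp [sdIter, sdIterHomotopy]
  | succ N ih =>
    have h := d_sdHomotopy n (sdIter R k (n + 1) N c)
    simp only [sdIter, sdIterHomotopy, AddMonoidHom.add_apply, AddMonoidHom.comp_apply, map_add]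
    rw [← d_sdIter, add_add_add_comm, ih, h]
    abel

theorem map_sdIter (w : Fin k → stdSimplex ℝ (Fin l)) (N n : ℕ)
    (c : (Fin n → stdSimplex ℝ (Fin k)) →₀ R) :
    map (aff w) n (sdIter R k n N c) = sdIter R l n N (map (aff w) n c) := by
  induction N with
  | zero => rfl
  | succ N ih => simp [sdIter, map_sd, ih]

theorem map_sdIterHomotopy (w : Fin k → stdSimplex ℝ (Fin l)) (N n : ℕ)
    (c : (Fin n → stdSimplex ℝ (Fin k)) →₀ R) :
    map (aff w) (n + 1) (sdIterHomotopy R k n N c) = sdIterHomotopy R l n N (map (aff w) n c) := by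
  induction N with
  | zero => simp [sdIterHomotopy]
  | succ N ih => simp [sdIterHomotopy, map_sdHomotopy, map_sdIter, ih]

end TupleChain

/-! ### Mesh of iterated subdivisions. -/

theorem Finsupp.exists_mem_support_of_mem_support_map {α β R S : Type*} [AddCommMonoid R]
    [AddCommMonoid S] (f : (α →₀ R) →+ (β →₀ S)) {c : α →₀ R} {b : β}
    (hb : b ∈ (f c).support) : ∃ a ∈ c.support, b ∈ (f (.single a (c a))).support := by
  classical
  by_contra! h
  refine Finsupp.mem_support_iff.1 hb ?_
  conv_lhs => rw [← c.sum_single]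
  rw [Finsupp.sum, map_sum, Finsupp.finsetSum_apply]
  exact Finset.sum_eq_zero fun a ha => Finsupp.notMem_support_iff.1 (h a ha)

namespace stdSimplex

variable {k n : ℕ}

/-- The convex hull of a tuple of points of a simplex. -/
def hull (v : Fin n → stdSimplex ℝ (Fin k)) : Set (Fin k → ℝ) :=
  convexHull ℝ (Set.range fun i => (v i : Fin k → ℝ))

theorem mem_hull (v : Fin n → stdSimplex ℝ (Fin k)) (i : Fin n) : (v i : Fin k → ℝ) ∈ hull v :=
  subset_convexHull ℝ _ ⟨i, rfl⟩

theorem hull_subset {v : Fin n → stdSimplex ℝ (Fin k)} {s : Set (Fin k → ℝ)} (hs : Convex ℝ s)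
    (h : ∀ i, (v i : Fin k → ℝ) ∈ s) : hull v ⊆ s :=
  convexHull_min (Set.range_subset_iff.2 h) hs

theorem hull_subset_hull {m : ℕ} {v : Fin n → stdSimplex ℝ (Fin k)}
    {w : Fin m → stdSimplex ℝ (Fin k)} (h : ∀ i, (v i : Fin k → ℝ) ∈ hull w) : hull v ⊆ hull w :=
  hull_subset (convex_convexHull ℝ _) h

theorem aff_mem_hull (v : Fin n → stdSimplex ℝ (Fin k)) (t : stdSimplex ℝ (Fin n)) :
    (aff v t : Fin k → ℝ) ∈ hull v :=
  (convex_convexHull ℝ _).sum_mem (fun i _ => t.2.1 i) t.2.2 fun i _ => mem_hull v i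

/-- The difference v_i - b is the average of the n + 1 vectors v_i - v_j, of which the one with j =
i is zero; hence the factor n / (n + 1). -/
theorem dist_bary_le (v : Fin (n + 1) → stdSimplex ℝ (Fin k)) {D : ℝ}
    (hD : ∀ i j, dist (v i) (v j) ≤ D) (i : Fin (n + 1)) :
    dist (v i) (bary v) ≤ n / (n + 1) * D := by
  have hn : (0 : ℝ) < n + 1 := by positivity
  have key : (v i : Fin k → ℝ) - (bary v : Fin k → ℝ) =
      ((n : ℝ) + 1)⁻¹ • ∑ j : Fin n, ((v i : Fin k → ℝ) - (v (i.succAbove j) : Fin k → ℝ)) := by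
    have h : ∑ j : Fin n, ((v i : Fin k → ℝ) - (v (i.succAbove j) : Fin k → ℝ)) =
        ∑ j : Fin (n + 1), ((v i : Fin k → ℝ) - (v j : Fin k → ℝ)) := by
      rw [Fin.sum_univ_succAbove _ i]
      simp
    have hb : (bary v : Fin k → ℝ) = ((n : ℝ) + 1)⁻¹ • ∑ j, (v j : Fin k → ℝ) := by
      rw [bary, coe_aff, Finset.smul_sum]
      refine Finset.sum_congr rfl fun j _ => congrArg (· • _) ?_
      change ((Fintype.card (Fin (n + 1)) : ℝ))⁻¹ = _
      simp
    rw [h, hb, Finset.sum_sub_distrib, smul_sub]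
    congr 1
    rw [Finset.sum_const, Finset.card_univ, Fintype.card_fin, ← Nat.cast_smul_eq_nsmul ℝ, smul_smul]
    push_cast
    rw [inv_mul_cancel₀ hn.ne', one_smul]
  rw [Subtype.dist_eq, dist_eq_norm]
  change ‖(v i : Fin k → ℝ) - (bary v : Fin k → ℝ)‖ ≤ _
  rw [key, norm_smul, norm_inv, Real.norm_of_nonneg hn.le]
  calc ((n : ℝ) + 1)⁻¹ * _ ≤ ((n : ℝ) + 1)⁻¹ * ∑ _j : Fin n, D := by
        gcongr
        refine (norm_sum_le _ _).trans (Finset.sum_le_sum fun j _ => ?_)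
        have := hD i (i.succAbove j)
        rwa [Subtype.dist_eq, dist_eq_norm] at this
    _ = _ := by simp; ring

end stdSimplex

namespace TupleChain

open stdSimplex

variable {R : Type*} [AddCommGroup R] {k n : ℕ}

theorem exists_succAbove_of_mem_support_d {v : Fin (n + 1) → stdSimplex ℝ (Fin k)} {g : R}
    {w : Fin n → stdSimplex ℝ (Fin k)} (hw : w ∈ (d _ R n (.single v g)).support) :
    ∃ i : Fin (n + 1), w = v ∘ i.succAbove := by
  classical
  by_contra! h
  refine Finsupp.mem_support_iff.1 hw ?_
  rw [d_single, Finsupp.finsetSum_apply]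
  refine Finset.sum_eq_zero fun i _ => ?_
  rw [Finsupp.smul_apply, Finsupp.single_eq_of_ne (h i), smul_zero]

theorem exists_cons_of_mem_support_cone {p : stdSimplex ℝ (Fin k)}
    {c : (Fin n → stdSimplex ℝ (Fin k)) →₀ R} {w : Fin (n + 1) → stdSimplex ℝ (Fin k)}
    (hw : w ∈ (cone p n c).support) : ∃ v ∈ c.support, w = Fin.cons p v := by
  classical
  obtain ⟨v, hv, h⟩ := Finset.mem_image.1 (Finsupp.mapDomain_support hw)
  exact ⟨v, hv, h.symm⟩

/-- Here n counts vertices, so the factor is slightly weaker than the optimal (n - 1) / n, but it is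
below 1 and needs no subtraction. Containment in the hull is part of the induction because it bounds
distances to the new apex. -/
theorem mesh_sd {v w : Fin n → stdSimplex ℝ (Fin k)} {g : R}
    (hw : w ∈ (sd R k n (.single v g)).support) :
    (∀ i, (w i : Fin k → ℝ) ∈ hull v) ∧ ∀ D, (∀ i j, dist (v i) (v j) ≤ D) →
      ∀ i j, dist (w i) (w j) ≤ n / (n + 1) * D := by
  induction n generalizing g with
  | zero => exact ⟨fun i => i.elim0, fun _ _ i => i.elim0⟩
  | succ n ih =>
    rw [sd_succ_single] at hw
    obtain ⟨w, hw', rfl⟩ := exists_cons_of_mem_support_cone hw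
    obtain ⟨v', hv', hw'⟩ := Finsupp.exists_mem_support_of_mem_support_map (sd R k n) hw'
    obtain ⟨l, rfl⟩ := exists_succAbove_of_mem_support_d hv'
    obtain ⟨h1, h2⟩ := ih hw'
    have hl : hull (v ∘ l.succAbove) ⊆ hull v :=
      hull_subset_hull (v := v ∘ l.succAbove) fun j => mem_hull v (l.succAbove j)
    have h3 : ∀ i, (w i : Fin k → ℝ) ∈ hull v := fun i => hl (h1 i)
    refine ⟨fun i => ?_, fun D hD => ?_⟩
    · refine Fin.cases ?_ (fun i => ?_) i
      · rw [Fin.cons_zero]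
        exact aff_mem_hull v _
      · rw [Fin.cons_succ]
        exact h3 i
    have hD0 : 0 ≤ D := dist_nonneg.trans (hD 0 0)
    have hle : (n : ℝ) / (n + 1) * D ≤ (n + 1 : ℕ) / ((n + 1 : ℕ) + 1) * D := by
      refine mul_le_mul_of_nonneg_right ?_ hD0
      rw [div_le_div_iff₀ (by positivity) (by positivity)]
      push_cast
      nlinarith
    -- A closed ball around the barycenter that contains the vertices of v contains their convex
    -- hull, hence every `w i`.
    have h4 : ∀ i, dist (w i) (bary v) ≤ (n + 1 : ℕ) / ((n + 1 : ℕ) + 1) * D := fun i =>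
      (hull_subset (convex_closedBall (bary v : Fin k → ℝ) _) (dist_bary_le v hD) (h3 i)).trans hle
    intro i j
    refine Fin.cases ?_ (fun i => ?_) i <;> refine Fin.cases ?_ (fun j => ?_) j
    · simp only [Fin.cons_zero, dist_self]; positivity
    · simpa [dist_comm] using h4 j
    · simpa using h4 i
    · exact (h2 D (fun i j => hD _ _) i j).trans hle

theorem mesh_sdIter {v : Fin n → stdSimplex ℝ (Fin k)} {g : R} {D : ℝ}
    (hD : ∀ i j, dist (v i) (v j) ≤ D) (N : ℕ) {w : Fin n → stdSimplex ℝ (Fin k)}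
    (hw : w ∈ (sdIter R k n N (.single v g)).support) (i j : Fin n) :
    dist (w i) (w j) ≤ ((n : ℝ) / (n + 1)) ^ N * D := by
  induction N generalizing w i j with
  | zero =>
    classical
    obtain rfl := Finset.mem_singleton.1 (Finsupp.support_single_subset hw)
    simpa using hD i j
  | succ N ih =>
    obtain ⟨w', hw', hw⟩ := Finsupp.exists_mem_support_of_mem_support_map (sd R k n) hw
    rw [pow_succ', mul_assoc]
    exact (mesh_sd hw).2 _ (ih hw') i j

/-- Once the mesh is below a Lebesgue number of the cover, each simplex lies in a ball around its
first vertex, by convexity. The "eventually" form lets finitely many simplices share one N. -/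
theorem eventually_range_aff_subset {U V : Set (stdSimplex ℝ (Fin k))} (hU : IsOpen U)
    (hV : IsOpen V) (hUV : U ∪ V = Set.univ) (c : (Fin n → stdSimplex ℝ (Fin k)) →₀ R) :
    ∀ᶠ N in Filter.atTop, ∀ w ∈ (sdIter R k n N c).support,
      Set.range (aff w) ⊆ U ∨ Set.range (aff w) ⊆ V := by
  suffices h : ∀ v ∈ c.support, ∀ᶠ N in Filter.atTop, ∀ w ∈ (sdIter R k n N
      (.single v (c v))).support, Set.range (aff w) ⊆ U ∨ Set.range (aff w) ⊆ V by
    filter_upwards [(Filter.eventually_all_finset _).2 h] with N hN w hw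
    obtain ⟨v, hv, hw⟩ := Finsupp.exists_mem_support_of_mem_support_map _ hw
    exact hN v hv w hw
  intro v _
  obtain ⟨δ, hδ, hball⟩ := lebesgue_number_lemma_of_metric (c := fun b : Bool => cond b U V)
    isCompact_univ (by rintro (_ | _) <;> assumption)
    (fun x _ => (hUV ▸ Set.mem_univ x : x ∈ U ∪ V).elim
      (fun h => Set.mem_iUnion.2 ⟨true, h⟩) fun h => Set.mem_iUnion.2 ⟨false, h⟩)
  obtain ⟨D, hD⟩ : ∃ D, ∀ i j, dist (v i) (v j) ≤ D :=
    ⟨Metric.diam (Set.univ : Set (stdSimplex ℝ (Fin k))), fun i j =>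
      Metric.dist_le_diam_of_mem isCompact_univ.isBounded trivial trivial⟩
  have hlim : Filter.Tendsto (fun N => ((n : ℝ) / (n + 1)) ^ N * D) Filter.atTop (nhds 0) := by
    simpa using (tendsto_pow_atTop_nhds_zero_of_lt_one (r := (n : ℝ) / (n + 1)) (by positivity)
      ((div_lt_one (by positivity)).2 (by linarith))).mul_const D
  filter_upwards [hlim.eventually_lt_const hδ] with N hN w hw
  -- With no vertices the domain is empty, and there is no first vertex to center a ball at.
  rcases n with _ | n
  · left
    rintro _ ⟨t, rfl⟩
    simpa using t.2.2
  obtain ⟨b, hb⟩ := hball (w 0) trivial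
  have hsub : Set.range (aff w) ⊆ cond b U V := by
    rintro _ ⟨t, rfl⟩
    exact hb (hull_subset (convex_ball (w 0 : Fin k → ℝ) δ)
      (fun i => (mesh_sdIter hD N hw i 0).trans_lt hN) (aff_mem_hull w t))
  cases b
  · exact .inr hsub
  · exact .inl hsub

end TupleChain

/-! ### Singular chains and their subdivision. -/

namespace SingularChain

open stdSimplex

variable {X : Type*} [TopologicalSpace X] {R : Type*} [AddCommGroup R] {k l n m : ℕ}

/-- The affine map with prescribed values at the vertices, as a continuous map. -/
noncomputable def affMap (v : Fin n → stdSimplex ℝ (Fin k)) :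
    C(stdSimplex ℝ (Fin n), stdSimplex ℝ (Fin k)) :=
  ⟨aff v, continuous_aff v⟩

/-- A face of a singular simplex. -/
noncomputable def face (i : Fin (n + 1)) (σ : C(stdSimplex ℝ (Fin (n + 1)), X)) :
    C(stdSimplex ℝ (Fin n), X) :=
  σ.comp (affMap (vertex ∘ i.succAbove))

/-- The boundary of the augmented singular chain complex, in which simplices are indexed by
their number of vertices, so that the unique map `stdSimplex ℝ (Fin 0) → X` accounts for the
augmentation. -/
noncomputable def d (X R : Type*) [TopologicalSpace X] [AddCommGroup R] (n : ℕ) :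
    (C(stdSimplex ℝ (Fin (n + 1)), X) →₀ R) →+ (C(stdSimplex ℝ (Fin n), X) →₀ R) :=
  ∑ i : Fin (n + 1), (-1 : ℤ) ^ (i : ℕ) • Finsupp.mapDomain.addMonoidHom (face i)

theorem d_single (σ : C(stdSimplex ℝ (Fin (n + 1)), X)) (g : R) :
    d X R n (.single σ g) = ∑ i : Fin (n + 1), (-1 : ℤ) ^ (i : ℕ) • .single (face i σ) g := by
  simp [d]

/-- The boundary of the augmented singular chain complex, extended by zero in degree zero. -/
noncomputable def d' (X R : Type*) [TopologicalSpace X] [AddCommGroup R] : (n : ℕ) →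
    (C(stdSimplex ℝ (Fin n), X) →₀ R) →+ (C(stdSimplex ℝ (Fin (n - 1)), X) →₀ R)
  | 0 => 0
  | n + 1 => d X R n

/-- The singular chains obtained by composing a singular simplex with affine simplices. -/
noncomputable def push (σ : C(stdSimplex ℝ (Fin k), X)) (n : ℕ) :
    ((Fin n → stdSimplex ℝ (Fin k)) →₀ R) →+ (C(stdSimplex ℝ (Fin n), X) →₀ R) :=
  Finsupp.mapDomain.addMonoidHom fun v => σ.comp (affMap v)

@[simp]
theorem push_single (σ : C(stdSimplex ℝ (Fin k), X)) (v : Fin n → stdSimplex ℝ (Fin k)) (g : R) :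
    push σ n (.single v g) = .single (σ.comp (affMap v)) g := by
  simp [push]

/-- Every singular simplex is the pushforward of the identity simplex `vertex`, so identities
between natural operators need only be known for affine chains. -/
theorem push_single_vertex (σ : C(stdSimplex ℝ (Fin n), X)) (g : R) :
    push σ n (.single vertex g) = .single σ g := by
  rw [push_single]
  congr 1
  ext t
  exact congrArg σ (vertex_aff t)

theorem affMap_comp (w : Fin k → stdSimplex ℝ (Fin l)) (v : Fin n → stdSimplex ℝ (Fin k)) :
    (affMap w).comp (affMap v) = affMap (aff w ∘ v) := by
  ext1 t
  exact (aff_aff w v t).symm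

theorem push_comp_affMap (σ : C(stdSimplex ℝ (Fin l), X)) (w : Fin k → stdSimplex ℝ (Fin l))
    (c : (Fin n → stdSimplex ℝ (Fin k)) →₀ R) :
    push (σ.comp (affMap w)) n c = push σ n (TupleChain.map (aff w) n c) := by
  induction c using Finsupp.induction_linear with
  | zero => simp
  | add a b ha hb => simp [ha, hb]
  | single v g => simp [← affMap_comp, ContinuousMap.comp_assoc]

theorem d_push (σ : C(stdSimplex ℝ (Fin k), X))
    (c : (Fin (n + 1) → stdSimplex ℝ (Fin k)) →₀ R) :
    d X R n (push σ (n + 1) c) = push σ n (TupleChain.d _ R n c) := by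
  induction c using Finsupp.induction_linear with
  | zero => simp
  | add a b ha hb => simp [ha, hb]
  | single v g =>
    simp only [push_single, d_single, TupleChain.d_single, map_sum, map_zsmul, face,
      ContinuousMap.comp_assoc, affMap_comp, ← Function.comp_assoc, aff_comp_vertex]

theorem d_d (c : C(stdSimplex ℝ (Fin (n + 2)), X) →₀ R) : d X R n (d X R (n + 1) c) = 0 := by
  induction c using Finsupp.induction_linear with
  | zero => simp
  | add a b ha hb => simp [ha, hb]
  | single σ g => rw [← push_single_vertex, d_push, d_push, TupleChain.d_d, map_zero]

theorem d'_d (c : C(stdSimplex ℝ (Fin (n + 1)), X) →₀ R) : d' X R n (d X R n c) = 0 := by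
  cases n
  · rfl
  · exact d_d c

/-- The extension to singular chains of an operator on affine chains. -/
noncomputable def extend (X : Type*) [TopologicalSpace X]
    (Φ : ((Fin n → stdSimplex ℝ (Fin n)) →₀ R) →+ ((Fin m → stdSimplex ℝ (Fin n)) →₀ R)) :
    (C(stdSimplex ℝ (Fin n), X) →₀ R) →+ (C(stdSimplex ℝ (Fin m), X) →₀ R) :=
  Finsupp.liftAddHom fun σ => (push σ m).comp (Φ.comp (Finsupp.singleAddHom vertex))

theorem extend_single
    (Φ : ((Fin n → stdSimplex ℝ (Fin n)) →₀ R) →+ ((Fin m → stdSimplex ℝ (Fin n)) →₀ R))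
    (σ : C(stdSimplex ℝ (Fin n), X)) (g : R) :
    extend X Φ (.single σ g) = push σ m (Φ (.single vertex g)) := by
  simp [extend]

/-- `extend` evaluates Φ on identity simplices only; naturality `hΦ` makes the result agree with Φ
on every affine simplex, in particular on faces. -/
theorem extend_push
    (Φ : ∀ k, ((Fin n → stdSimplex ℝ (Fin k)) →₀ R) →+ ((Fin m → stdSimplex ℝ (Fin k)) →₀ R))
    (hΦ : ∀ k l (w : Fin k → stdSimplex ℝ (Fin l)) (c : (Fin n → stdSimplex ℝ (Fin k)) →₀ R),
      TupleChain.map (aff w) m (Φ k c) = Φ l (TupleChain.map (aff w) n c))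
    (σ : C(stdSimplex ℝ (Fin k), X)) (c : (Fin n → stdSimplex ℝ (Fin k)) →₀ R) :
    extend X (Φ n) (push σ n c) = push σ m (Φ k c) := by
  induction c using Finsupp.induction_linear with
  | zero => simp
  | add a b ha hb => simp [ha, hb]
  | single v g =>
    rw [push_single, extend_single, push_comp_affMap, hΦ, TupleChain.map_single, aff_comp_vertex]

/-- The `N`-fold barycentric subdivision of singular chains. -/
noncomputable def sdIter (X R : Type*) [TopologicalSpace X] [AddCommGroup R] (N n : ℕ) :
    (C(stdSimplex ℝ (Fin n), X) →₀ R) →+ (C(stdSimplex ℝ (Fin n), X) →₀ R) :=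
  extend X (TupleChain.sdIter R n n N)

/-- The chain homotopy between the identity and the `N`-fold barycentric subdivision. -/
noncomputable def sdIterHomotopy (X R : Type*) [TopologicalSpace X] [AddCommGroup R] (N n : ℕ) :
    (C(stdSimplex ℝ (Fin n), X) →₀ R) →+ (C(stdSimplex ℝ (Fin (n + 1)), X) →₀ R) :=
  extend X (TupleChain.sdIterHomotopy R n n N)

theorem d_sdIterHomotopy (N : ℕ) (c : C(stdSimplex ℝ (Fin (n + 1)), X) →₀ R) :
    d X R (n + 1) (sdIterHomotopy X R N (n + 1) c) + sdIterHomotopy X R N n (d X R n c) =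
      c - sdIter X R N (n + 1) c := by
  induction c using Finsupp.induction_linear with
  | zero => simp
  | add a b ha hb =>
    simp only [map_add]
    rw [add_sub_add_comm, ← ha, ← hb]
    abel
  | single σ g =>
    rw [← push_single_vertex, d_push]
    simp only [sdIterHomotopy, sdIter]
    rw [extend_push (fun k => TupleChain.sdIterHomotopy R k (n + 1) N)
        (fun k l w c => TupleChain.map_sdIterHomotopy w N _ c),
      extend_push (fun k => TupleChain.sdIterHomotopy R k n N)
        (fun k l w c => TupleChain.map_sdIterHomotopy w N _ c),
      extend_push (fun k => TupleChain.sdIter R k (n + 1) N)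
        (fun k l w c => TupleChain.map_sdIter w N _ c), d_push, ← map_add, ← map_sub,
      TupleChain.d_sdIterHomotopy]

/-- The chains all of whose simplices lie in a given set. -/
def chainsIn (R : Type*) [AddCommGroup R] (A : Set X) (n : ℕ) :
    Submodule ℤ (C(stdSimplex ℝ (Fin n), X) →₀ R) :=
  Finsupp.supported R ℤ {σ | Set.range σ ⊆ A}

variable {A B : Set X}

theorem chainsIn_mono (h : A ⊆ B) : chainsIn R A n ≤ chainsIn R B n :=
  fun _ hc _ hσ => (hc hσ).trans h

theorem mem_chainsIn_inter {c : C(stdSimplex ℝ (Fin n), X) →₀ R} (hA : c ∈ chainsIn R A n)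
    (hB : c ∈ chainsIn R B n) : c ∈ chainsIn R (A ∩ B) n :=
  fun _ hσ => Set.subset_inter (hA hσ) (hB hσ)

theorem d_mem_chainsIn {c : C(stdSimplex ℝ (Fin (n + 1)), X) →₀ R}
    (hc : c ∈ chainsIn R A (n + 1)) : d X R n c ∈ chainsIn R A n := by
  classical
  rw [d, AddMonoidHom.finsetSum_apply]
  refine Submodule.sum_mem _ fun i _ => Submodule.smul_mem _ _ fun _ hτ => ?_
  obtain ⟨σ, hσ, rfl⟩ := Finset.mem_image.1 (Finsupp.mapDomain_support hτ)
  exact (Set.range_comp_subset_range _ σ).trans (hc hσ)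

theorem extend_mem_chainsIn
    (Φ : ((Fin n → stdSimplex ℝ (Fin n)) →₀ R) →+ ((Fin m → stdSimplex ℝ (Fin n)) →₀ R))
    {c : C(stdSimplex ℝ (Fin n), X) →₀ R} (hc : c ∈ chainsIn R A n) :
    extend X Φ c ∈ chainsIn R A m := by
  classical
  intro τ hτ
  obtain ⟨σ, hσ, hτ⟩ := Finsupp.exists_mem_support_of_mem_support_map (extend X Φ) hτ
  rw [extend_single] at hτ
  obtain ⟨v, -, rfl⟩ := Finset.mem_image.1 (Finsupp.mapDomain_support hτ)
  exact (Set.range_comp_subset_range _ σ).trans (hc hσ)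

/-- Each simplex of c pulls A and B back to an open cover of its compact domain; finiteness of the
support gives a common N. -/
theorem exists_sdIter_mem_sup (hA : IsOpen A) (hB : IsOpen B)
    {c : C(stdSimplex ℝ (Fin n), X) →₀ R} (hc : c ∈ chainsIn R (A ∪ B) n) :
    ∃ N, sdIter X R N n c ∈ chainsIn R A n ⊔ chainsIn R B n := by
  classical
  have key : ∀ σ ∈ c.support, ∀ᶠ N in Filter.atTop, ∀ τ ∈
      (sdIter X R N n (.single σ (c σ))).support, Set.range τ ⊆ A ∨ Set.range τ ⊆ B := by
    intro σ hσ
    filter_upwards [TupleChain.eventually_range_aff_subset (hA.preimage σ.continuous)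
      (hB.preimage σ.continuous) (Set.eq_univ_of_forall fun t => hc hσ ⟨t, rfl⟩)
      (.single vertex (c σ))] with N hN τ hτ
    rw [sdIter, extend_single] at hτ
    obtain ⟨v, hv, rfl⟩ := Finset.mem_image.1 (Finsupp.mapDomain_support hτ)
    rw [ContinuousMap.coe_comp, Set.range_comp, Set.image_subset_iff, Set.image_subset_iff]
    exact hN v hv
  obtain ⟨N, hN⟩ := ((Filter.eventually_all_finset _).2 key).exists
  refine ⟨N, ?_⟩
  rw [chainsIn, chainsIn, ← Finsupp.supported_union]
  intro τ hτ
  obtain ⟨σ, hσ, hτ⟩ := Finsupp.exists_mem_support_of_mem_support_map (sdIter X R N n) hτ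
  exact hN σ hσ τ hτ

/-! ### Mayer–Vietoris for two open sets. -/

/-- A cycle of `A ∪ B` is homologous to the sum of a chain of `A` and a chain of `B`. -/
theorem exists_eq_d_add_add (hA : IsOpen A) (hB : IsOpen B)
    {z : C(stdSimplex ℝ (Fin (n + 1)), X) →₀ R} (hz : z ∈ chainsIn R (A ∪ B) (n + 1))
    (hdz : d X R n z = 0) : ∃ w ∈ chainsIn R (A ∪ B) (n + 2), ∃ a ∈ chainsIn R A (n + 1),
      ∃ b ∈ chainsIn R B (n + 1), z = d X R (n + 1) w + (a + b) := by
  obtain ⟨N, hN⟩ := exists_sdIter_mem_sup hA hB hz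
  obtain ⟨a, ha, b, hb, hab⟩ := Submodule.mem_sup.1 hN
  refine ⟨_, extend_mem_chainsIn (TupleChain.sdIterHomotopy R _ _ N) hz, a, ha, b, hb, ?_⟩
  have h := d_sdIterHomotopy N z
  rw [hdz, map_zero, add_zero] at h
  rw [hab]
  exact (sub_eq_iff_eq_add.1 h.symm)

/-- If the sum of a chain of `A` and a chain of `B` bounds in `A ∪ B`, then it is the boundary of
such a sum. -/
theorem exists_d_add_eq (hA : IsOpen A) (hB : IsOpen B)
    {w : C(stdSimplex ℝ (Fin (n + 1)), X) →₀ R} (hw : w ∈ chainsIn R (A ∪ B) (n + 1))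
    {a b : C(stdSimplex ℝ (Fin n), X) →₀ R} (ha : a ∈ chainsIn R A n) (hb : b ∈ chainsIn R B n)
    (hdw : d X R n w = a + b) : ∃ a' ∈ chainsIn R A (n + 1), ∃ b' ∈ chainsIn R B (n + 1),
      d X R n (a' + b') = a + b := by
  obtain ⟨N, hN⟩ := exists_sdIter_mem_sup hA hB hw
  obtain ⟨a₁, ha₁, b₁, hb₁, hab⟩ := Submodule.mem_sup.1 hN
  -- Applying d to the homotopy formula gives d(sd w + T(dw)) = dw, with T the homotopy. Since dw =
  -- a + b, the chain T(dw) splits as T(a) + T(b), and T preserves chains of A and of B.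
  refine ⟨a₁ + sdIterHomotopy X R N n a, add_mem ha₁ (extend_mem_chainsIn _ ha),
    b₁ + sdIterHomotopy X R N n b, add_mem hb₁ (extend_mem_chainsIn _ hb), ?_⟩
  have h := congrArg (d X R n) (d_sdIterHomotopy N w)
  rw [map_add, d_d, zero_add, map_sub, ← hab, hdw] at h
  rw [add_add_add_comm, ← map_add, map_add (d X R n), h]
  abel

/-- Vanishing of the reduced homology of `A`, where degrees count vertices: every cycle of `A` is
the boundary of a chain of `A`. -/
def Acyclic (R : Type*) [AddCommGroup R] (A : Set X) (n : ℕ) : Prop :=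
  ∀ z ∈ chainsIn R A n, d' X R n z = 0 → ∃ w ∈ chainsIn R A (n + 1), d X R n w = z

/-- The simplex without vertices has empty range, so it lies in every set; a filling found in A
serves for A ∪ B. -/
theorem Acyclic.union_zero (h : Acyclic R A 0) : Acyclic R (A ∪ B) 0 := by
  intro z _ hz
  obtain ⟨w, hw, h⟩ := h z (fun _ _ => by rintro _ ⟨t, -⟩; simpa using t.2.2) hz
  exact ⟨w, chainsIn_mono Set.subset_union_left hw, h⟩

/-- After subdivision a cycle is a + b up to a boundary. Then da = -db is a cycle of A ∩ B, filled
there by some e, and the cycles a - e and b + e bound in A and in B. -/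
theorem Acyclic.union (hA : IsOpen A) (hB : IsOpen B) (hA' : Acyclic R A (n + 1))
    (hB' : Acyclic R B (n + 1)) (hAB : Acyclic R (A ∩ B) n) : Acyclic R (A ∪ B) (n + 1) := by
  intro z hz hdz
  obtain ⟨w, hw, a, ha, b, hb, rfl⟩ := exists_eq_d_add_add hA hB hz hdz
  change d X R n _ = 0 at hdz
  rw [map_add, d_d, zero_add, map_add] at hdz
  have hdb : d X R n a ∈ chainsIn R B n := by
    rw [eq_neg_of_add_eq_zero_left hdz]
    exact neg_mem (d_mem_chainsIn hb)
  obtain ⟨e, he, hde⟩ := hAB _ (mem_chainsIn_inter (d_mem_chainsIn ha) hdb) (d'_d a)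
  obtain ⟨a', ha', hda⟩ := hA' (a - e) (sub_mem ha (chainsIn_mono Set.inter_subset_left he))
    (by change d X R n _ = 0; rw [map_sub, hde, sub_self])
  obtain ⟨b', hb', hdb⟩ := hB' (b + e) (add_mem hb (chainsIn_mono Set.inter_subset_right he))
    (by change d X R n _ = 0; rw [map_add, hde, add_comm, hdz])
  refine ⟨w + (a' + b'), add_mem hw (add_mem (chainsIn_mono Set.subset_union_left ha')
    (chainsIn_mono Set.subset_union_right hb')), ?_⟩
  rw [map_add, map_add (d X R (n + 1)) a', hda, hdb]
  abel

/-- Fill z by a in A and by b in B. The cycle a - b bounds in A ∪ B, hence equals d(a' + b') with a'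
in A and b' in B; then a - da' = b + db' lies in A ∩ B and still fills z. -/
theorem Acyclic.inter (hA : IsOpen A) (hB : IsOpen B) (hA' : Acyclic R A n)
    (hB' : Acyclic R B n) (hAB : Acyclic R (A ∪ B) (n + 1)) : Acyclic R (A ∩ B) n := by
  intro z hz hdz
  obtain ⟨a, ha, rfl⟩ := hA' z (chainsIn_mono Set.inter_subset_left hz) hdz
  obtain ⟨b, hb, hab⟩ := hB' _ (chainsIn_mono Set.inter_subset_right hz) hdz
  obtain ⟨w, hw, hdw⟩ := hAB (a - b) (sub_mem (chainsIn_mono Set.subset_union_left ha)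
    (chainsIn_mono Set.subset_union_right hb))
    (by change d X R n _ = 0; rw [map_sub, hab, sub_self])
  obtain ⟨a', ha', b', hb', h⟩ := exists_d_add_eq hA hB hw ha (neg_mem hb)
    (by rw [hdw, sub_eq_add_neg])
  rw [map_add] at h
  refine ⟨a - d X R (n + 1) a', mem_chainsIn_inter (sub_mem ha (d_mem_chainsIn ha')) ?_, ?_⟩
  · have : a - d X R (n + 1) a' = b + d X R (n + 1) b' := by
      rw [sub_eq_iff_eq_add, add_assoc, add_comm (d X R (n + 1) b'), h]
      abel
    rw [this]
    exact add_mem hb (d_mem_chainsIn hb')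
  · rw [map_sub, d_d, sub_zero]

end SingularChain

/-! ### Comparison with the augmented singular chain complex. -/

namespace SingularChain

open stdSimplex

section Comparison

variable (G : Type v) [AddCommGroup G] (Y : Type u) [TopologicalSpace Y]

/-- The comparison of finitely supported functions with the coproduct defining singular chains. -/
noncomputable def toSingular (n : ℕ) :
    (C(stdSimplex ℝ (Fin (n + 1)), Y) →₀ ULift.{u} G) →+
      ((TopCat.toSSet.obj (TopCat.of Y)).chainComplex (AddCommGrpCat.of (ULift.{u} G))).X n :=
  Finsupp.liftAddHom fun σ =>
    ((TopCat.toSSet.obj (TopCat.of Y)).ιChainComplex (R := AddCommGrpCat.of (ULift.{u} G))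
      ((TopCat.toSSetObjEquiv _ (Opposite.op (SimplexCategory.mk n))).symm σ)).hom

variable {G Y}

theorem toSingular_single (n : ℕ) (σ : C(stdSimplex ℝ (Fin (n + 1)), Y)) (g : ULift.{u} G) :
    toSingular G Y n (.single σ g) =
      ((TopCat.toSSet.obj (TopCat.of Y)).ιChainComplex (R := AddCommGrpCat.of (ULift.{u} G))
      ((TopCat.toSSetObjEquiv _ (Opposite.op (SimplexCategory.mk n))).symm σ)).hom g := by
  simp [toSingular]

/-- The inverse comes from the universal property of the coproduct, sending the summand of x to
chains supported at x. -/
theorem toSingular_bijective (n : ℕ) : Function.Bijective (toSingular G Y n) := by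
  let K := TopCat.toSSet.obj (TopCat.of Y)
  let M := AddCommGrpCat.of (ULift.{u} G)
  let e := TopCat.toSSetObjEquiv (TopCat.of Y) (Opposite.op (SimplexCategory.mk n))
  let inv : (K.chainComplex M).X n ⟶
      AddCommGrpCat.of (C(stdSimplex ℝ (Fin (n + 1)), Y) →₀ ULift.{u} G) :=
    (K.isColimitChainComplexXCofan M n).desc
      (Cofan.mk _ fun x => AddCommGrpCat.ofHom (Finsupp.singleAddHom (e x)))
  have hinv : ∀ x, K.ιChainComplex x ≫ inv = AddCommGrpCat.ofHom (Finsupp.singleAddHom (e x)) :=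
    fun x => (K.isColimitChainComplexXCofan M n).fac _ (Discrete.mk x)
  have h1 : inv ≫ AddCommGrpCat.ofHom (toSingular G Y n) = 𝟙 _ := by
    refine SSet.chainComplex_hom_ext fun x => ?_
    rw [← Category.assoc, hinv]
    ext g
    change toSingular G Y n (.single (e x) g) = _
    rw [toSingular_single, Equiv.symm_apply_apply]
    rfl
  have h2 : ∀ c, inv.hom (toSingular G Y n c) = c := by
    intro c
    induction c using Finsupp.induction_linear with
    | zero => simp
    | add a b ha hb => simp [ha, hb]
    | single σ g =>
      rw [toSingular_single]
      refine (congr(($(hinv (e.symm σ))).hom g)).trans ?_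
      change Finsupp.single (e (e.symm σ)) g = _
      rw [Equiv.apply_symm_apply]
  refine ⟨Function.LeftInverse.injective h2, fun x => ⟨inv.hom x, ?_⟩⟩
  exact congr(($h1).hom x)

theorem _root_.AddCommGrpCat.hom_finsetSum {M N : AddCommGrpCat.{v}} {ι : Type*} (s : Finset ι)
    (f : ι → (M ⟶ N)) : (∑ i ∈ s, f i).hom = ∑ i ∈ s, (f i).hom :=
  map_sum (AddMonoidHom.mk' (fun f : M ⟶ N => f.hom) fun _ _ => rfl) f s

theorem toSSetObjEquiv_symm_face (n : ℕ) (i : Fin (n + 2))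
    (σ : C(stdSimplex ℝ (Fin (n + 2)), Y)) :
    (TopCat.toSSet.obj (TopCat.of Y)).δ i ((TopCat.toSSetObjEquiv (TopCat.of Y)
      (Opposite.op (SimplexCategory.mk (n + 1)))).symm σ) =
    (TopCat.toSSetObjEquiv (TopCat.of Y) (Opposite.op (SimplexCategory.mk n))).symm (face i σ) := by
  rw [Equiv.eq_symm_apply]
  ext t
  change σ (stdSimplex.map (SimplexCategory.δ i) t) = σ (aff (vertex ∘ i.succAbove) t)
  congr 1
  ext j
  rw [aff_apply, map_coe, FunOnFinite.linearMap_apply_apply, Finset.sum_filter]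
  refine Finset.sum_congr rfl fun x _ => ?_
  change (if i.succAbove x = j then t x else 0) = t x * (Pi.single (i.succAbove x) 1 : _ → ℝ) j
  simp [Pi.single_apply, eq_comm]

theorem d_toSingular (n : ℕ) (c : C(stdSimplex ℝ (Fin (n + 2)), Y) →₀ ULift.{u} G) :
    (((TopCat.toSSet.obj (TopCat.of Y)).chainComplex
      (AddCommGrpCat.of (ULift.{u} G))).d (n + 1) n).hom (toSingular G Y (n + 1) c) =
    toSingular G Y n (d Y _ (n + 1) c) := by
  induction c using Finsupp.induction_linear with
  | zero => simp
  | add a b ha hb => simp only [map_add, ha, hb]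
  | single σ g =>
    rw [toSingular_single, d_single, map_sum]
    have h := SSet.ιChainComplex_d (TopCat.toSSet.obj (TopCat.of Y))
      (R := AddCommGrpCat.of (ULift.{u} G)) ((TopCat.toSSetObjEquiv _
        (Opposite.op (SimplexCategory.mk (n + 1)))).symm σ)
    refine congr(($h).hom g).trans ?_
    rw [AddCommGrpCat.hom_finsetSum, AddMonoidHom.finsetSum_apply]
    refine Finset.sum_congr rfl fun i _ => ?_
    rw [map_zsmul, toSingular_single, ← toSSetObjEquiv_symm_face]
    rfl

variable (G Y) in
/-- The augmentation part of the comparison. -/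
noncomputable def toCoefficients : (C(stdSimplex ℝ (Fin 0), Y) →₀ ULift.{u} G) →+ ULift.{u} G :=
  Finsupp.liftAddHom fun _ => AddMonoidHom.id _

theorem toCoefficients_bijective : Function.Bijective (toCoefficients G Y) := by
  have : IsEmpty (stdSimplex ℝ (Fin 0)) := ⟨fun t => by simpa using t.2.2⟩
  have : Unique C(stdSimplex ℝ (Fin 0), Y) :=
    { default := ⟨isEmptyElim, by fun_prop⟩, uniq := fun _ => by ext t; exact isEmptyElim t }
  constructor
  · intro a b h
    rw [Finsupp.unique_single a, Finsupp.unique_single b] at h ⊢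
    simpa [toCoefficients] using h
  · intro g
    exact ⟨.single default g, by simp [toCoefficients]⟩

theorem augmentation_toSingular (c : C(stdSimplex ℝ (Fin 1), Y) →₀ ULift.{u} G) :
    (chainAugmentation (TopCat.toSSet.obj (TopCat.of Y))
      (AddCommGrpCat.of (ULift.{u} G))).hom (toSingular G Y 0 c) =
    toCoefficients G Y (d Y _ 0 c) := by
  induction c using Finsupp.induction_linear with
  | zero => simp
  | add a b ha hb => simp only [map_add, ha, hb]
  | single σ g =>
    rw [toSingular_single, d_single]
    have h := ι_chainAugmentation (TopCat.toSSet.obj (TopCat.of Y))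
      (AddCommGrpCat.of (ULift.{u} G)) ((TopCat.toSSetObjEquiv _
        (Opposite.op (SimplexCategory.mk 0))).symm σ)
    refine congr(($h).hom g).trans ?_
    simp [toCoefficients]

variable (G Y) in
/-- The comparison of finitely supported functions with augmented singular chains. -/
noncomputable def toAugmented : (n : ℕ) → (C(stdSimplex ℝ (Fin n), Y) →₀ ULift.{u} G) →+
    (augmentedSingularChainComplex G Y).X n
  | 0 => toCoefficients G Y
  | n + 1 => toSingular G Y n

theorem toAugmented_bijective : (n : ℕ) → Function.Bijective (toAugmented G Y n)
  | 0 => toCoefficients_bijective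
  | n + 1 => toSingular_bijective n

theorem d_toAugmented : (n : ℕ) → (c : C(stdSimplex ℝ (Fin (n + 1)), Y) →₀ ULift.{u} G) →
    ((augmentedSingularChainComplex G Y).d (n + 1) n).hom (toAugmented G Y (n + 1) c) =
      toAugmented G Y n (d Y _ n c)
  | 0, c => augmentation_toSingular c
  | n + 1, c => d_toSingular n c

theorem isZero_homology_iff (n : ℕ) : IsZero ((augmentedSingularChainComplex G Y).homology n) ↔
    ∀ z : C(stdSimplex ℝ (Fin n), Y) →₀ ULift.{u} G, d' Y _ n z = 0 → ∃ w, d Y _ n w = z := by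
  have hb : ∀ z, (∃ x, ((augmentedSingularChainComplex G Y).d (n + 1) n).hom x =
      toAugmented G Y n z) ↔ ∃ w, d Y _ n w = z := by
    intro z
    rw [(toAugmented_bijective (n + 1)).surjective.exists]
    simp only [d_toAugmented, (toAugmented_bijective n).injective.eq_iff]
  rw [← HomologicalComplex.exactAt_iff_isZero_homology,
    HomologicalComplex.exactAt_iff' _ (n + 1) n (n - 1) (by simp) (by cases n <;> simp),
    ShortComplex.ab_exact_iff]
  change (∀ x : (augmentedSingularChainComplex G Y).X n, ((augmentedSingularChainComplex G Y).d n
    (n - 1)).hom x = 0 → ∃ y, ((augmentedSingularChainComplex G Y).d (n + 1) n).hom y = x) ↔ _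
  rw [(toAugmented_bijective n).surjective.forall]
  refine forall_congr' fun z => ?_
  rw [hb]
  refine imp_congr ?_ Iff.rfl
  cases n with
  | zero =>
    -- The truncated index 0 - 1 is 0; the differential from degree 0 to itself is zero, and so is
    -- `d'` there.
    rw [(augmentedSingularChainComplex G Y).shape 0 (0 - 1) (by simp)]
    exact iff_of_true rfl rfl
  | succ n =>
    change ((augmentedSingularChainComplex G Y).d (n + 1) n).hom _ = 0 ↔ d Y _ n z = 0
    rw [d_toAugmented, map_eq_zero_iff _ (toAugmented_bijective n).injective]

end Comparison

/-! ### Chains of a subspace as chains of the ambient space. -/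

section Subspace

variable {X : Type*} [TopologicalSpace X] {R : Type*} [AddCommGroup R] (A : Set X)

/-- The map on chains induced by the inclusion of a subspace. -/
noncomputable def incl (R : Type*) [AddCommGroup R] (n : ℕ) :
    (C(stdSimplex ℝ (Fin n), A) →₀ R) →+ (C(stdSimplex ℝ (Fin n), X) →₀ R) :=
  Finsupp.mapDomain.addMonoidHom fun σ => ContinuousMap.comp ⟨Subtype.val, continuous_subtype_val⟩ σ

variable {A}

theorem incl_injective (n : ℕ) : Function.Injective (incl A R n) := by
  refine Finsupp.mapDomain_injective fun σ τ h => ?_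
  ext t
  exact congr($h t)

theorem incl_mem_chainsIn (n : ℕ) (c : C(stdSimplex ℝ (Fin n), A) →₀ R) :
    incl A R n c ∈ chainsIn R A n := by
  classical
  intro τ hτ
  obtain ⟨σ, -, rfl⟩ := Finset.mem_image.1 (Finsupp.mapDomain_support hτ)
  rintro _ ⟨t, rfl⟩
  exact (σ t).2

theorem exists_incl_eq {n : ℕ} {c : C(stdSimplex ℝ (Fin n), X) →₀ R} (hc : c ∈ chainsIn R A n) :
    ∃ c', incl A R n c' = c := by
  rw [← c.sum_single, Finsupp.sum]
  refine (AddMonoidHom.mem_range (f := incl A R n)).1 (sum_mem fun σ hσ => ?_)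
  refine ⟨.single ⟨fun t => ⟨σ t, hc hσ ⟨t, rfl⟩⟩, by fun_prop⟩ (c σ), ?_⟩
  rw [incl, Finsupp.mapDomain.addMonoidHom_apply, Finsupp.mapDomain_single]
  rfl

theorem d_incl (n : ℕ) (c : C(stdSimplex ℝ (Fin (n + 1)), A) →₀ R) :
    d X R n (incl A R (n + 1) c) = incl A R n (d A R n c) := by
  induction c using Finsupp.induction_linear with
  | zero => simp
  | add a b ha hb => simp [ha, hb]
  | single σ g => simp [incl, d_single, face, ContinuousMap.comp_assoc]

/-- Inclusion is an injective chain map whose image is exactly `chainsIn R A`. -/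
theorem acyclic_iff (n : ℕ) : Acyclic R A n ↔
    ∀ z : C(stdSimplex ℝ (Fin n), A) →₀ R, d' A R n z = 0 → ∃ w, d A R n w = z := by
  have hd : ∀ z, d' X R n (incl A R n z) = 0 ↔ d' A R n z = 0 := by
    intro z
    cases n with
    | zero => exact iff_of_true rfl rfl
    | succ n =>
      change d X R n _ = 0 ↔ d A R n z = 0
      rw [d_incl, map_eq_zero_iff _ (incl_injective n)]
  constructor
  · intro h z hz
    obtain ⟨w, hw, hdw⟩ := h _ (incl_mem_chainsIn n z) ((hd z).2 hz)
    obtain ⟨w, rfl⟩ := exists_incl_eq hw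
    exact ⟨w, incl_injective n ((d_incl n w).symm.trans hdw)⟩
  · intro h z hz hdz
    obtain ⟨z, rfl⟩ := exists_incl_eq hz
    obtain ⟨w, rfl⟩ := h z ((hd z).1 hdz)
    exact ⟨_, incl_mem_chainsIn _ w, d_incl n w⟩

end Subspace

theorem isZero_reducedSingularHomology_iff (G : Type v) [AddCommGroup G] {X : Type u}
    [TopologicalSpace X] (A : Set X) {q : ℤ} {n : ℕ} (h : q + 1 = n) :
    IsZero (reducedSingularHomology G A q) ↔ Acyclic (ULift.{u} G) A n := by
  rw [acyclic_iff, ← isZero_homology_iff]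
  obtain rfl : q = (n : ℤ) - 1 := by omega
  cases n with
  | zero => rfl
  | succ n =>
    rw [Nat.cast_succ, add_sub_cancel_right]
    rfl

/-! ### Induction on the number of open sets. -/

variable {X : Type*} [TopologicalSpace X] {R : Type*} [AddCommGroup R]

theorem iUnion_eq_castSucc_union_last {X : Type*} {m : ℕ} (A : Fin (m + 1) → Set X) :
    ⋃ i, A i = (⋃ i : Fin m, A i.castSucc) ∪ A (Fin.last m) := by
  ext x
  simp only [Set.mem_iUnion, Set.mem_union]
  constructor
  · rintro ⟨i, hi⟩
    induction i using Fin.lastCases with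
    | last => exact .inr hi
    | cast i => exact .inl ⟨i, hi⟩
  · rintro (⟨i, hi⟩ | h)
    exacts [⟨_, hi⟩, ⟨_, h⟩]

theorem iInter_map_castSucc {X : Type*} {m : ℕ} (A : Fin (m + 1) → Set X) (s : Finset (Fin m)) :
    ⋂ i ∈ s.map Fin.castSuccEmb, A i = ⋂ i ∈ s, A i.castSucc := by
  ext x
  simp

theorem iInter_insert_last {X : Type*} {m : ℕ} (A : Fin (m + 1) → Set X) {s : Finset (Fin m)}
    (hs : s.Nonempty) : ⋂ i ∈ insert (Fin.last m) (s.map Fin.castSuccEmb), A i =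
      ⋂ i ∈ s, (A i.castSucc ∩ A (Fin.last m)) := by
  obtain ⟨j, hj⟩ := hs
  ext x
  simp only [Set.mem_iInter, Finset.mem_insert, Finset.mem_map, forall_eq_or_imp,
    forall_exists_index, and_imp, forall_apply_eq_imp_iff₂, Set.mem_inter_iff]
  exact ⟨fun h i hi => ⟨h.2 i hi, h.1⟩, fun h => ⟨(h j hj).2, fun i hi => (h i hi).1⟩⟩

/-- Split off the last set. It meets the union of the others in the union of the A_i ∩ A_last; an
intersection of these over s involves one more of the original sets, which matches the drop of one
degree. As k is a natural number, nothing is asked below degree -1. -/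
theorem acyclic_iUnion {m n : ℕ} (A : Fin (m + 1) → Set X) (hA : ∀ i, IsOpen (A i))
    (h : ∀ s : Finset (Fin (m + 1)), s.Nonempty → ∀ k, n + 1 = k + s.card →
      Acyclic R (⋂ i ∈ s, A i) k) : Acyclic R (⋃ i, A i) n := by
  induction m generalizing n with
  | zero =>
    have := h {0} (by simp) n (by simp)
    rw [iUnion_eq_castSucc_union_last]
    simpa using this
  | succ m ih =>
    have hU : Acyclic R (⋃ i : Fin (m + 1), A i.castSucc) n := by
      refine ih _ (fun i => hA _) fun s hs k hk => ?_
      have := h (s.map Fin.castSuccEmb) (hs.map) k (by simpa using hk)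
      rwa [iInter_map_castSucc] at this
    rw [iUnion_eq_castSucc_union_last]
    cases n with
    | zero => exact hU.union_zero
    | succ n =>
      refine hU.union (isOpen_iUnion fun i => hA _) (hA _)
        (by simpa using h {Fin.last _} (by simp) (n + 1) (by simp)) ?_
      rw [Set.iUnion_inter]
      refine ih _ (fun i => (hA _).inter (hA _)) fun s hs k hk => ?_
      rw [← iInter_insert_last A hs]
      refine h _ (by simp) k ?_
      rw [Finset.card_insert_of_notMem (by simp), Finset.card_map]
      omega

/-- Passing to the sets A_i ∩ A_last lowers m by one and adds `last` to each index set s, so m + n -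
|s| is unchanged. -/
theorem acyclic_iInter {m n : ℕ} (A : Fin (m + 1) → Set X) (hA : ∀ i, IsOpen (A i))
    (hU : Acyclic R (⋃ i, A i) (m + n))
    (h : ∀ s : Finset (Fin (m + 1)), s.Nonempty → s.card ≤ m → ∀ k, m + n = k + s.card →
      Acyclic R (⋂ i ∈ s, A i) k) : Acyclic R (⋂ i, A i) n := by
  induction m with
  | zero =>
    rw [iUnion_eq_castSucc_union_last, zero_add] at hU
    have : ⋂ i, A i = A 0 := by ext x; simp [Fin.forall_fin_one]
    simpa [this] using hU
  | succ m ih =>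
    have hI : ⋂ i, A i = ⋂ i : Fin (m + 1), (A i.castSucc ∩ A (Fin.last _)) := by
      have := iInter_insert_last A (Finset.univ_nonempty (α := Fin (m + 1)))
      simp only [Finset.mem_univ, Set.iInter_true] at this
      rw [← this]
      refine Set.iInter_congr fun i => ?_
      induction i using Fin.lastCases <;> simp
    rw [hI]
    refine ih _ (fun i => (hA _).inter (hA _)) ?_ fun s hs hsm k hk => ?_
    · rw [← Set.iUnion_inter]
      refine Acyclic.inter (isOpen_iUnion fun i => hA _) (hA _)
        (acyclic_iUnion _ (fun i => hA _) fun s hs k hk => ?_) ?_ ?_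
      · have := h (s.map Fin.castSuccEmb) hs.map
          (by simpa using s.card_le_univ) k (by rw [Finset.card_map]; omega)
        rwa [iInter_map_castSucc] at this
      · simpa using h {Fin.last _} (by simp) (by simp) (m + n) (by simp; omega)
      -- The third input of `Acyclic.inter` is the union of the whole family, one degree higher.
      · rw [← iUnion_eq_castSucc_union_last]
        convert hU using 1
        omega
    · rw [← iInter_insert_last A hs]
      have hc : (insert (Fin.last (m + 1)) (s.map Fin.castSuccEmb)).card = s.card + 1 := by
        rw [Finset.card_insert_of_notMem (by simp), Finset.card_map]
      exact h _ (by simp) (by omega) k (by omega)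

end SingularChain

theorem mainTheorem7 (G : Type v) [AddCommGroup G] [Nontrivial G]
    (X : Type u) [TopologicalSpace X] (m lam : ℕ) (hm : 1 ≤ m)
    (A : Fin m → Set X) (hA : ∀ i, IsOpen (A i))
    (hUnion : IsZero (reducedSingularHomology G (⋃ i, A i : Set X) ((m : ℤ) - 2 + lam)))
    (hInter : ∀ s : Finset (Fin m), 1 ≤ s.card → s.card ≤ m - 1 →
      IsZero (reducedSingularHomology G (⋂ i ∈ s, A i : Set X)
        ((m : ℤ) - 2 - s.card + lam))) :
    IsZero (reducedSingularHomology G (⋂ i, A i : Set X) ((lam : ℤ) - 1)) := by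
  obtain ⟨m, rfl⟩ := Nat.exists_eq_add_of_le' hm
  rw [SingularChain.isZero_reducedSingularHomology_iff G _ (n := lam) (by simp)]
  -- There are now m + 1 sets, so the degree is m - 1 + λ, that is, m + λ vertices.
  rw [SingularChain.isZero_reducedSingularHomology_iff G _ (n := m + lam) (by push_cast; ring)]
    at hUnion
  refine SingularChain.acyclic_iInter A hA hUnion fun s hs hsm k hk => ?_
  rw [← SingularChain.isZero_reducedSingularHomology_iff G _ (q := (m + 1 : ℕ) - 2 - s.card + lam)
    (by push_cast; omega)]
  exact hInter s hs.card_pos hsm
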